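/- Write $[n]=\{1,\dots,n\}$. A function $f:[n]\to[n]$ is two-to-one if every value it takes has exactly two preimages. There is an absolute constant $C$ such that for every integer $n\ge 1$ and every real $w\in[0,n]$ there is a quantum verifier $V$ with oracle access to $f$ (through the unitary $|i,b\rangle\mapsto|i,b+f(i)\bmod n\rangle$), whose unitaries between queries do not depend on $f$, with the following properties. 1. $V$ receives a classical witness of at most $w\log_2 n$ bits. 2. $V$ makes at most $C\cdot\min\{\sqrt{n/w},\,n^{1/3}\}$ quantum queries to $f$, where $\sqrt{n/0}$ is read as $\infty$. 3. (Completeness) If $f:[n]\to[n]$ is one-to-one, then there is a witness $y$ such that $V$, given $f$ and $y$, accepts with probability at least $2/3$. 4. (Soundness) If $f:[n]\to[n]$ is two-to-one, then for every witness $y$, $V$, given $f$ and $y$, accepts with probability at most $1/3$. That is, there is a $\mathsf{QCMA}$ protocol for the collision problem (verifying that $f$ is one-to-one rather than two-to-one) with a $(w\log n)$-bit classical witness and $O(\min\{\sqrt{n/w},\,n^{1/3}\})$ quantum queries. -/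

import Mathlib

open scoped Matrix

/-- `f` is two-to-one: every value that `f` takes has exactly two preimages. -/
def IsTwoToOne {n : ℕ} (f : Fin n → Fin n) : Prop :=
  ∀ x : Fin n, {x' : Fin n | f x' = f x}.ncard = 2

/-- Labels of the computational basis of a verifier's memory: the query register `i`, the
answer register `b`, the register holding a `k`-bit classical witness, and further workspace
with basis `A`. -/
abbrev BasisLabel (n k : ℕ) (A : Type) : Type :=
  Fin n × Fin n × (Fin k → Bool) × A

/-- The standard quantum oracle of `f : [n] → [n]`, that is, the linear map with
`|i, b, y, a⟩ ↦ |i, b + f i, y, a⟩` (addition mod `n`), acting on amplitude vectors. -/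
def oracleApply {n k : ℕ} {A : Type} (f : Fin n → Fin n) (ψ : BasisLabel n k A → ℂ) :
    BasisLabel n k A → ℂ :=
  fun s => ψ (s.1, s.2.1 - f s.1, s.2.2.1, s.2.2.2)

/-- A quantum verifier (bounded-query quantum circuit) for functions `[n] → [n]` that receives
a classical witness of `k` bits. It starts in the basis state `|i₀, b₀, y, a₀⟩`, where `y` is the
witness and `i₀, b₀, a₀` are fixed, applies
`U queries ∘ O_f ∘ U (queries - 1) ∘ ⋯ ∘ O_f ∘ U 0` with unitaries `U t` that depend neither on
`f` nor on the witness, measures in the computational basis, and accepts if the outcome lies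
in `accept`. (The matrices `U t` with `t > queries` are never used.) -/
structure QuantumVerifier (n k : ℕ) where
  /-- basis of the workspace -/
  A : Type
  [fintypeA : Fintype A]
  [decEqA : DecidableEq A]
  /-- the number of oracle queries -/
  queries : ℕ
  /-- initial content of the query register -/
  i₀ : Fin n
  /-- initial content of the answer register -/
  b₀ : Fin n
  /-- initial content of the workspace -/
  a₀ : A
  /-- the unitaries between the queries -/
  U : ℕ → Matrix.unitaryGroup (BasisLabel n k A) ℂ
  /-- accepting measurement outcomes -/
  accept : Finset (BasisLabel n k A)

attribute [instance] QuantumVerifier.fintypeA QuantumVerifier.decEqA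

namespace QuantumVerifier

variable {n k : ℕ}

/-- The state after the first `t` queries to `f` (and the unitary following the last of them),
on witness `y`. -/
noncomputable def state (V : QuantumVerifier n k) (f : Fin n → Fin n) (y : Fin k → Bool) :
    ℕ → (BasisLabel n k V.A → ℂ)
  | 0 => (V.U 0 : Matrix (BasisLabel n k V.A) (BasisLabel n k V.A) ℂ) *ᵥ
      Pi.single (V.i₀, V.b₀, y, V.a₀) 1
  | t + 1 => (V.U (t + 1) : Matrix (BasisLabel n k V.A) (BasisLabel n k V.A) ℂ) *ᵥ
      oracleApply f (V.state f y t)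

/-- The probability that the verifier accepts, given oracle access to `f` and the witness `y`. -/
noncomputable def acceptProb (V : QuantumVerifier n k) (f : Fin n → Fin n)
    (y : Fin k → Bool) : ℝ :=
  ∑ s ∈ V.accept, ‖V.state f y V.queries s‖ ^ 2

/-- `V` is a `QCMA` protocol, with completeness and soundness errors `1/3`, for verifying that
`f : [n] → [n]` is one-to-one, under the promise that it is one-to-one or two-to-one. -/
def IsCollisionProtocol (V : QuantumVerifier n k) : Prop :=
  (∀ f : Fin n → Fin n, Function.Injective f →
      ∃ y : Fin k → Bool, 2 / 3 ≤ V.acceptProb f y) ∧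
  (∀ f : Fin n → Fin n, IsTwoToOne f →
      ∀ y : Fin k → Bool, V.acceptProb f y ≤ 1 / 3)

end QuantumVerifier

/-- `min {√(n / w), n^{1/3}}`, where `√(n / 0)` is read as `∞`. -/
noncomputable def collisionQueryBound (n : ℕ) (w : ℝ) : ℝ :=
  if w = 0 then (n : ℝ) ^ (1 / 3 : ℝ)
  else min (Real.sqrt ((n : ℝ) / w)) ((n : ℝ) ^ (1 / 3 : ℝ))

/-!
A table `τ` of claimed values of `f` at `r` positions is either read off the witness or loaded by
`r` queries. Relative to `τ` an input `x` is `Marked` if the pair `(x, f x)` contradicts the table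
or exhibits a collision with it. If `f` is one-to-one and `τ` is honest, nothing is marked
(`not_marked_of_injective`). If `f` is two-to-one, then at least `r / 2` of the `n` inputs are marked
whatever `τ` is (`IsTwoToOne.le_two_mul_card_marked`). So it remains to tell whether marked inputs
exist, with `O(√(n / r))` queries and without an error when there are none.

Let `G` be the Grover iteration and `1` the uniform vector. If no input is marked, then `G 1 = 1`.
If `m` inputs are marked, then `1 = v - G v`, where `v` is `n / (2 m)` times the indicator of the
marked set (`sub_groverStep_indicator`), so the sum of `T` iterates telescopes and the average of
`G^i 1` over `T` consecutive exponents `i` has norm `O(√(n / m) / T)` relative to that of `1`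
(`card_mul_norm_sum_groverStep_sq_le`). The overlap of this average with `1` is the acceptance
amplitude of a circuit with a clock register in uniform superposition, each value of which applies
a different power of `G` (`exists_search_verifier`); the acceptance probability is exactly `1` if
nothing is marked and at most `n / (m T ^ 2)` otherwise. No trigonometry and no repetition are
needed, and the number of marked inputs need not be known.

With `r = ⌈n^{1/3}⌉` loaded values, `T = 3 r` suffices; with `r = ⌊w / 2⌋` values from the witness,
`T = ⌈√(6 n / r)⌉` does. The factor `1 / 2` in `r` leaves room for rounding `r * log₂ n` up to a
whole number of bits.
-/

/-! ### States preparable with few queries -/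

section Prep

variable {n k : ℕ} {A : Type} [Fintype A] [DecidableEq A]

theorem QuantumVerifier.state_congr {q q' : ℕ} {i₀ b₀ : Fin n} {a₀ : A}
    {U U' : ℕ → Matrix.unitaryGroup (BasisLabel n k A) ℂ}
    {acc acc' : Finset (BasisLabel n k A)} (f : Fin n → Fin n) (y : Fin k → Bool) {N : ℕ}
    (h : ∀ t ≤ N, U t = U' t) :
    (QuantumVerifier.mk A q i₀ b₀ a₀ U acc).state f y N =
      (QuantumVerifier.mk A q' i₀ b₀ a₀ U' acc').state f y N := by
  induction N with
  | zero => simp only [QuantumVerifier.state, h 0 le_rfl]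
  | succ N ih =>
    simp only [QuantumVerifier.state, h (N + 1) le_rfl]
    rw [ih fun t ht => h t (by omega)]

/-- The family of states `S f y` is preparable from `|i₀, b₀, y, a₀⟩` with `q` queries to `f`, by a
circuit whose unitaries depend neither on `f` nor on the witness `y`. -/
def Preparable (i₀ b₀ : Fin n) (a₀ : A) (q : ℕ)
    (S : (Fin n → Fin n) → (Fin k → Bool) → BasisLabel n k A → ℂ) : Prop :=
  ∃ U : ℕ → Matrix.unitaryGroup (BasisLabel n k A) ℂ, ∀ acc f y,
    (QuantumVerifier.mk A q i₀ b₀ a₀ U acc).state f y q = S f y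

theorem mem_unitaryGroup_of_sum_norm_sq {B : Type*} [Fintype B] [DecidableEq B]
    (M : Matrix B B ℂ) (h : ∀ ψ : B → ℂ, ∑ s, ‖(M *ᵥ ψ) s‖ ^ 2 = ∑ s, ‖ψ s‖ ^ 2) :
    M ∈ Matrix.unitaryGroup B ℂ := by
  have key : star (Matrix.toEuclideanCLM (𝕜 := ℂ) M) * Matrix.toEuclideanCLM (𝕜 := ℂ) M = 1 := by
    refine (ContinuousLinearMap.norm_map_iff_adjoint_comp_self _).1 fun x => ?_
    have := h x.ofLp
    rw [EuclideanSpace.norm_eq, EuclideanSpace.norm_eq]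
    congr 1
  rw [← map_star, ← map_mul] at key
  rw [Matrix.mem_unitaryGroup_iff']
  exact (Matrix.toEuclideanCLM (n := B) (𝕜 := ℂ)).injective (key.trans (map_one _).symm)

theorem Preparable.init (i₀ b₀ : Fin n) (a₀ : A) :
    Preparable (k := k) i₀ b₀ a₀ 0 fun _ y => Pi.single (i₀, b₀, y, a₀) 1 :=
  ⟨fun _ => 1, fun acc f y => by
    simp only [QuantumVerifier.state, Matrix.UnitaryGroup.one_val, Matrix.one_mulVec]⟩

theorem Preparable.query {i₀ b₀ : Fin n} {a₀ : A} {q : ℕ}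
    {S : (Fin n → Fin n) → (Fin k → Bool) → BasisLabel n k A → ℂ}
    (h : Preparable i₀ b₀ a₀ q S) :
    Preparable i₀ b₀ a₀ (q + 1) fun f y => oracleApply f (S f y) := by
  obtain ⟨U, hU⟩ := h
  refine ⟨Function.update U (q + 1) 1, fun acc f y => ?_⟩
  beta_reduce
  rw [← hU acc f y, QuantumVerifier.state]
  simp only [Function.update_self, Matrix.UnitaryGroup.one_val, Matrix.one_mulVec]
  congr 1
  exact QuantumVerifier.state_congr f y fun t ht => Function.update_of_ne (by omega) _ _

theorem Preparable.isometry {i₀ b₀ : Fin n} {a₀ : A} {q : ℕ}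
    {S : (Fin n → Fin n) → (Fin k → Bool) → BasisLabel n k A → ℂ}
    (h : Preparable i₀ b₀ a₀ q S)
    (J : (BasisLabel n k A → ℂ) →ₗ[ℂ] (BasisLabel n k A → ℂ))
    (hJ : ∀ ψ, ∑ s, ‖J ψ s‖ ^ 2 = ∑ s, ‖ψ s‖ ^ 2) :
    Preparable i₀ b₀ a₀ q fun f y => J (S f y) := by
  obtain ⟨U, hU⟩ := h
  have hmv : ∀ ψ, LinearMap.toMatrix' J *ᵥ ψ = J ψ := fun ψ => LinearMap.toMatrix'_mulVec J ψ
  let W : Matrix.unitaryGroup (BasisLabel n k A) ℂ :=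
    ⟨LinearMap.toMatrix' J, mem_unitaryGroup_of_sum_norm_sq _ fun ψ => by
      simpa only [hmv] using hJ ψ⟩
  have hW : ∀ (V : Matrix.unitaryGroup (BasisLabel n k A) ℂ) ψ,
      ((W * V : Matrix.unitaryGroup (BasisLabel n k A) ℂ) :
        Matrix (BasisLabel n k A) (BasisLabel n k A) ℂ) *ᵥ ψ = J (V.1 *ᵥ ψ) := fun V ψ => by
    rw [Matrix.UnitaryGroup.mul_val, ← Matrix.mulVec_mulVec]
    exact hmv _
  refine ⟨Function.update U q (W * U q), fun acc f y => ?_⟩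
  beta_reduce
  rw [← hU acc f y]
  cases q with
  | zero => simp only [QuantumVerifier.state, Function.update_self, hW]
  | succ q =>
    simp only [QuantumVerifier.state, Function.update_self, hW]
    congr 3
    exact QuantumVerifier.state_congr f y fun t ht => Function.update_of_ne (by omega) _ _

theorem Preparable.perm {i₀ b₀ : Fin n} {a₀ : A} {q : ℕ}
    {S : (Fin n → Fin n) → (Fin k → Bool) → BasisLabel n k A → ℂ}
    (h : Preparable i₀ b₀ a₀ q S) (σ : Equiv.Perm (BasisLabel n k A)) :
    Preparable i₀ b₀ a₀ q fun f y s => S f y (σ s) :=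
  h.isometry (LinearMap.funLeft ℂ ℂ σ) fun ψ =>
    Equiv.sum_comp σ fun s => ‖ψ s‖ ^ 2

theorem Preparable.phase {i₀ b₀ : Fin n} {a₀ : A} {q : ℕ}
    {S : (Fin n → Fin n) → (Fin k → Bool) → BasisLabel n k A → ℂ}
    (h : Preparable i₀ b₀ a₀ q S) (P : BasisLabel n k A → Prop) [DecidablePred P] :
    Preparable i₀ b₀ a₀ q fun f y s => if P s then -S f y s else S f y s := by
  refine h.isometry
    { toFun := fun ψ s => if P s then -ψ s else ψ s
      map_add' := fun φ ψ => by ext s; by_cases hs : P s <;> simp [hs, add_comm]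
      map_smul' := fun c ψ => by ext s; by_cases hs : P s <;> simp [hs] } fun ψ => ?_
  refine Finset.sum_congr rfl fun s _ => ?_
  by_cases hs : P s <;> simp [hs]

end Prep

/-! ### Marked inputs -/

section Marking

variable {n r : ℕ}

/-- Given claimed values `τ` at the positions `ι`, the pair `(x, v)` is marked if `f x = v` is
evidence that `f` is not one-to-one or that the claim is false: the claimed values are not
distinct, or `v` differs from the value claimed at `x`, or `x` is not one of the positions and yet
`v` is one of the claimed values. -/
def Marked (ι τ : Fin r → Fin n) (x v : Fin n) : Prop :=
  ¬ Function.Injective τ ∨ (∃ i, ι i = x ∧ τ i ≠ v) ∨ ((∀ i, ι i ≠ x) ∧ ∃ i, τ i = v)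

theorem not_marked_of_injective {ι : Fin r → Fin n} (hι : Function.Injective ι)
    {f : Fin n → Fin n} (hf : Function.Injective f) (x : Fin n) :
    ¬ Marked ι (fun i => f (ι i)) x (f x) := by
  rintro (h | ⟨i, rfl, h⟩ | ⟨h, i, hi⟩)
  · exact h (hf.comp hι)
  · exact h rfl
  · exact h i (hf hi)

theorem IsTwoToOne.exists_partner {f : Fin n → Fin n} (hf : IsTwoToOne f) (x : Fin n) :
    ∃ x', x' ≠ x ∧ f x' = f x := by
  obtain ⟨x', hx', hne⟩ := Set.exists_ne_of_one_lt_ncard (s := {x' | f x' = f x})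
    (by rw [hf x]; norm_num) x
  exact ⟨x', hne, hx'⟩

open Classical in
/-- Against a two-to-one function, every table of claimed values leads to many marked inputs: a
position with a false claim is marked, and the partner of a position with a true claim is marked;
at least half of the positions are of the same kind. -/
theorem IsTwoToOne.le_two_mul_card_marked {ι : Fin r → Fin n} (hι : Function.Injective ι)
    (τ : Fin r → Fin n) {f : Fin n → Fin n} (hf : IsTwoToOne f) :
    r ≤ 2 * (Finset.univ.filter fun x => Marked ι τ x (f x)).card := by
  by_cases hτ : Function.Injective τ
  · choose p hp hfp using hf.exists_partner
    have hbad : (Finset.univ.filter fun i => ¬ τ i = f (ι i)).card ≤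
        (Finset.univ.filter fun x => Marked ι τ x (f x)).card := by
      refine Finset.card_le_card_of_injOn ι (fun i hi => ?_) hι.injOn
      simp only [Finset.coe_filter, Finset.mem_univ, true_and, Set.mem_ofPred_eq] at hi ⊢
      exact Or.inr (Or.inl ⟨i, rfl, hi⟩)
    have hgood : (Finset.univ.filter fun i => τ i = f (ι i)).card ≤
        (Finset.univ.filter fun x => Marked ι τ x (f x)).card := by
      refine Finset.card_le_card_of_injOn (fun i => p (ι i)) (fun i hi => ?_) ?_
      · simp only [Finset.coe_filter, Finset.mem_univ, true_and, Set.mem_ofPred_eq] at hi ⊢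
        by_cases hj : ∃ j, ι j = p (ι i)
        · obtain ⟨j, hj⟩ := hj
          refine Or.inr (Or.inl ⟨j, hj, fun h => ?_⟩)
          have hji : j = i := hτ (by rw [h, hi, hfp])
          exact hp (ι i) (by rw [← hj, hji])
        · exact Or.inr (Or.inr ⟨fun j h => hj ⟨j, h⟩, i, by rw [hi, hfp]⟩)
      · intro i hi j hj hij
        simp only [Finset.coe_filter, Finset.mem_univ, true_and, Set.mem_ofPred_eq] at hi hj
        exact hτ (by rw [hi, hj, ← hfp, ← hfp (ι j)]; exact congrArg f hij)
    have hsum := Finset.card_filter_add_card_filter_not (s := (Finset.univ : Finset (Fin r)))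
      (fun i => τ i = f (ι i))
    rw [Finset.card_univ, Fintype.card_fin] at hsum
    omega
  · have hrn : r ≤ n := by simpa using Fintype.card_le_of_injective ι hι
    have hall : (Finset.univ.filter fun x => Marked ι τ x (f x)) = Finset.univ :=
      Finset.filter_true_of_mem fun x _ => Or.inl hτ
    rw [hall, Finset.card_univ, Fintype.card_fin]
    omega

end Marking

/-! ### Averages of Grover iterates -/

section Grover

variable {n : ℕ}

/-- Grover's diffusion operator on `ℂⁿ`, the reflection through the line of constant vectors. -/
noncomputable def diffusion (n : ℕ) : (Fin n → ℂ) →ₗ[ℂ] (Fin n → ℂ) where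
  toFun φ x := 2 / n * ∑ x', φ x' - φ x
  map_add' φ ψ := by ext x; simp only [Pi.add_apply, Finset.sum_add_distrib]; ring
  map_smul' c φ := by
    ext x
    simp only [Pi.smul_apply, smul_eq_mul, ← Finset.mul_sum, RingHom.id_apply]
    ring

theorem diffusion_apply (φ : Fin n → ℂ) (x : Fin n) :
    diffusion n φ x = 2 / n * ∑ x', φ x' - φ x := rfl

theorem sum_norm_sq_diffusion [NeZero n] (φ : Fin n → ℂ) :
    ∑ x, ‖diffusion n φ x‖ ^ 2 = ∑ x, ‖φ x‖ ^ 2 := by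
  have hn : (n : ℝ) ≠ 0 := Nat.cast_ne_zero.2 (NeZero.ne n)
  set s := ∑ x, φ x with hs
  have hre : ∑ x, (φ x).re = s.re := by rw [hs, Complex.re_sum]
  have him : ∑ x, (φ x).im = s.im := by rw [hs, Complex.im_sum]
  have key : ∀ x, ‖diffusion n φ x‖ ^ 2 = ‖φ x‖ ^ 2 +
      (4 / n ^ 2 * (s.re ^ 2 + s.im ^ 2) - 4 / n * (s.re * (φ x).re + s.im * (φ x).im)) := by
    intro x
    have h2 : (2 / n * s : ℂ) = ((2 / n : ℝ) : ℂ) * s := by push_cast; rfl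
    rw [diffusion_apply, ← hs, h2, ← Complex.normSq_eq_norm_sq, ← Complex.normSq_eq_norm_sq,
      Complex.normSq_apply, Complex.normSq_apply]
    simp only [Complex.sub_re, Complex.sub_im, Complex.re_ofReal_mul, Complex.im_ofReal_mul]
    ring
  have hcross : ∑ x, (s.re * (φ x).re + s.im * (φ x).im) = s.re * s.re + s.im * s.im := by
    rw [Finset.sum_add_distrib, ← Finset.mul_sum, ← Finset.mul_sum, hre, him]
  rw [Finset.sum_congr rfl fun x _ => key x, Finset.sum_add_distrib, Finset.sum_sub_distrib,
    ← Finset.mul_sum Finset.univ (fun x => s.re * (φ x).re + s.im * (φ x).im), hcross,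
    Finset.sum_const, Finset.card_univ, Fintype.card_fin, nsmul_eq_mul]
  field_simp
  ring

/-- One Grover iteration with marked set `m`: negate the marked amplitudes, then apply the
diffusion operator. -/
noncomputable def groverStep (m : Finset (Fin n)) : (Fin n → ℂ) →ₗ[ℂ] (Fin n → ℂ) :=
  diffusion n ∘ₗ
    { toFun := fun φ x => if x ∈ m then -φ x else φ x
      map_add' := fun φ ψ => by ext x; by_cases hx : x ∈ m <;> simp [hx, add_comm]
      map_smul' := fun c φ => by ext x; by_cases hx : x ∈ m <;> simp [hx] }

theorem groverStep_apply (m : Finset (Fin n)) (φ : Fin n → ℂ) :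
    groverStep m φ = diffusion n fun x => if x ∈ m then -φ x else φ x := rfl

theorem sum_norm_sq_groverStep_pow [NeZero n] (m : Finset (Fin n)) (i : ℕ) (φ : Fin n → ℂ) :
    ∑ x, ‖(groverStep m ^ i) φ x‖ ^ 2 = ∑ x, ‖φ x‖ ^ 2 := by
  induction i with
  | zero => rfl
  | succ i ih =>
    rw [pow_succ', Module.End.mul_apply, groverStep_apply, sum_norm_sq_diffusion, ← ih]
    refine Finset.sum_congr rfl fun x _ => ?_
    split_ifs <;> simp

theorem diffusion_one [NeZero n] : diffusion n 1 = 1 := by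
  have hn : (n : ℂ) ≠ 0 := Nat.cast_ne_zero.2 (NeZero.ne n)
  ext x
  simp [diffusion_apply]
  field_simp
  norm_num

theorem groverStep_pow_one_of_empty [NeZero n] (i : ℕ) :
    (groverStep (∅ : Finset (Fin n)) ^ i) 1 = 1 := by
  induction i with
  | zero => rfl
  | succ i ih =>
    rw [pow_succ', Module.End.mul_apply, ih, groverStep_apply]
    simp only [Finset.notMem_empty, if_false]
    exact diffusion_one

/-- The uniform vector is a coboundary of the Grover iteration `G`: it is `v - G v` for a multiple
`v` of the indicator of the marked set. -/
theorem sub_groverStep_indicator [NeZero n] {m : Finset (Fin n)} (hm : m.Nonempty) :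
    let v : Fin n → ℂ := fun x => if x ∈ m then n / (2 * m.card) else 0
    v - groverStep m v = 1 := by
  intro v
  have hn : (n : ℂ) ≠ 0 := Nat.cast_ne_zero.2 (NeZero.ne n)
  have hc : (m.card : ℂ) ≠ 0 := Nat.cast_ne_zero.2 hm.card_pos.ne'
  have h1 : (fun x => if x ∈ m then -v x else v x) = -v := by
    ext x
    by_cases hx : x ∈ m <;> simp [v, hx]
  ext x
  rw [Pi.sub_apply, groverStep_apply, h1, map_neg, Pi.neg_apply, diffusion_apply]
  have h2 : ∑ x, v x = n / 2 := by
    simp only [v, Finset.sum_ite_mem, Finset.univ_inter, Finset.sum_const, nsmul_eq_mul]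
    field_simp
  rw [h2, Pi.one_apply]
  field_simp
  ring

theorem norm_sum_sq_le (φ : Fin n → ℂ) : ‖∑ x, φ x‖ ^ 2 ≤ n * ∑ x, ‖φ x‖ ^ 2 := by
  calc ‖∑ x, φ x‖ ^ 2 ≤ (∑ x, ‖φ x‖) ^ 2 := by gcongr; exact norm_sum_le _ _
    _ ≤ n * ∑ x, ‖φ x‖ ^ 2 := by
      simpa using sq_sum_le_card_mul_sum_sq (s := Finset.univ) (f := fun x => ‖φ x‖)

/-- The sum of `T` Grover iterates of the uniform vector telescopes, so it stays bounded as `T`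
grows. -/
theorem card_mul_norm_sum_groverStep_sq_le [NeZero n] (m : Finset (Fin n)) (T : ℕ) :
    m.card * ‖∑ x, ∑ i ∈ Finset.range T, (groverStep m ^ (i + 1)) 1 x‖ ^ 2 ≤ (n : ℝ) ^ 3 := by
  rcases m.eq_empty_or_nonempty with rfl | hm
  · simp only [Finset.card_empty, Nat.cast_zero, zero_mul]; positivity
  have hc : (0 : ℝ) < m.card := Nat.cast_pos.2 hm.card_pos
  set v : Fin n → ℂ := fun x => if x ∈ m then n / (2 * m.card) else 0 with hv
  have hv1 : (1 : Fin n → ℂ) = v - groverStep m v := (sub_groverStep_indicator hm).symm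
  have htel : ∑ i ∈ Finset.range T, (groverStep m ^ (i + 1)) 1 =
      (groverStep m ^ 1) v - (groverStep m ^ (T + 1)) v := by
    rw [← Finset.sum_range_sub' (fun i => (groverStep m ^ (i + 1)) v)]
    refine Finset.sum_congr rfl fun i _ => ?_
    conv_lhs => rw [hv1, map_sub, ← Module.End.mul_apply, ← pow_succ]
  have hnorm : ∑ x, ‖v x‖ ^ 2 = (n : ℝ) ^ 2 / (4 * m.card) := by
    have : ∀ x, ‖v x‖ ^ 2 = if x ∈ m then ((n : ℝ) / (2 * m.card)) ^ 2 else 0 := by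
      intro x
      by_cases hx : x ∈ m <;> simp [hv, hx]
    rw [Finset.sum_congr rfl fun x _ => this x, Finset.sum_ite_mem, Finset.univ_inter,
      Finset.sum_const, nsmul_eq_mul]
    field_simp
    ring
  have hbound : ∑ x, ‖∑ i ∈ Finset.range T, (groverStep m ^ (i + 1)) 1 x‖ ^ 2 ≤
      (n : ℝ) ^ 2 / m.card := by
    have hx : ∀ x, ‖∑ i ∈ Finset.range T, (groverStep m ^ (i + 1)) 1 x‖ ^ 2 ≤
        2 * ‖(groverStep m ^ 1) v x‖ ^ 2 + 2 * ‖(groverStep m ^ (T + 1)) v x‖ ^ 2 := by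
      intro x
      rw [← Finset.sum_apply, htel, Pi.sub_apply]
      have h1 := norm_sub_le ((groverStep m ^ 1) v x) ((groverStep m ^ (T + 1)) v x)
      have h2 := norm_nonneg ((groverStep m ^ 1) v x - (groverStep m ^ (T + 1)) v x)
      nlinarith [sq_nonneg (‖(groverStep m ^ 1) v x‖ - ‖(groverStep m ^ (T + 1)) v x‖)]
    refine (Finset.sum_le_sum fun x _ => hx x).trans_eq ?_
    rw [Finset.sum_add_distrib, ← Finset.mul_sum, ← Finset.mul_sum,
      sum_norm_sq_groverStep_pow, sum_norm_sq_groverStep_pow, hnorm]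
    field_simp
    ring
  calc m.card * ‖∑ x, ∑ i ∈ Finset.range T, (groverStep m ^ (i + 1)) 1 x‖ ^ 2
      ≤ m.card * (n * ((n : ℝ) ^ 2 / m.card)) := by
        gcongr
        exact (norm_sum_sq_le _).trans (by gcongr)
    _ = (n : ℝ) ^ 3 := by field_simp

end Grover

/-! ### The search verifier -/

section Verifier

variable {n k : ℕ} {C W : Type} [DecidableEq C] [DecidableEq W]

/-- The superposition of the basis states `|x, g x, y, (c, τ)⟩` with amplitudes `φ (x, c)`: the
answer register is a function of the query register, and the witness and the stored table are in
basis states. -/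
def tableState (g : Fin n → Fin n) (y : Fin k → Bool) (τ : W) (φ : Fin n × C → ℂ) :
    BasisLabel n k (C × W) → ℂ :=
  fun s => if s.2.1 = g s.1 ∧ s.2.2.1 = y ∧ s.2.2.2.2 = τ then φ (s.1, s.2.2.2.1) else 0

theorem oracleApply_tableState [NeZero n] {C : Type} (f g : Fin n → Fin n) (y : Fin k → Bool) (τ : W)
    (φ : Fin n × C → ℂ) :
    oracleApply f (tableState g y τ φ) = tableState (fun x => g x + f x) y τ φ := by
  ext s
  simp only [oracleApply, tableState, sub_eq_iff_eq_add]

theorem single_eq_tableState [NeZero n] (x : Fin n) (c : C) (y : Fin k → Bool) (τ : W) :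
    (Pi.single (x, 0, y, (c, τ)) 1 : BasisLabel n k (C × W) → ℂ) =
      tableState (fun _ => 0) y τ (Pi.single (x, c) 1) := by
  ext ⟨x', b, y', c', τ'⟩
  simp only [tableState, Pi.single_apply, Prod.mk.injEq]
  split_ifs <;> first | rfl | (exfalso; tauto)

theorem Preparable.block [Fintype C] [Fintype W] {i₀ b₀ : Fin n} {a₀ : C × W} {q : ℕ}
    {S : (Fin n → Fin n) → (Fin k → Bool) → BasisLabel n k (C × W) → ℂ}
    (h : Preparable i₀ b₀ a₀ q S) (K : (Fin n × C → ℂ) →ₗ[ℂ] (Fin n × C → ℂ))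
    (hK : ∀ φ, ∑ p, ‖K φ p‖ ^ 2 = ∑ p, ‖φ p‖ ^ 2) :
    Preparable i₀ b₀ a₀ q fun f y s =>
      K (fun p => S f y (p.1, s.2.1, s.2.2.1, (p.2, s.2.2.2.2))) (s.1, s.2.2.2.1) := by
  let e : BasisLabel n k (C × W) ≃ (Fin n × (Fin k → Bool) × W) × (Fin n × C) :=
    { toFun := fun s => ((s.2.1, s.2.2.1, s.2.2.2.2), (s.1, s.2.2.2.1))
      invFun := fun p => (p.2.1, p.1.1, p.1.2.1, (p.2.2, p.1.2.2))
      left_inv := fun _ => rfl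
      right_inv := fun _ => rfl }
  refine h.isometry
    { toFun := fun ψ s =>
        K (fun p => ψ (p.1, s.2.1, s.2.2.1, (p.2, s.2.2.2.2))) (s.1, s.2.2.2.1)
      map_add' := fun φ ψ => by
        ext s
        exact congrFun (K.map_add (fun p => φ (p.1, s.2.1, s.2.2.1, (p.2, s.2.2.2.2)))
          (fun p => ψ (p.1, s.2.1, s.2.2.1, (p.2, s.2.2.2.2)))) _
      map_smul' := fun c ψ => by
        ext s
        exact congrFun
          (K.map_smul c (fun p => ψ (p.1, s.2.1, s.2.2.1, (p.2, s.2.2.2.2)))) _ } fun ψ => ?_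
  rw [← e.symm.sum_comp, ← e.symm.sum_comp fun s => ‖ψ s‖ ^ 2]
  refine (Fintype.sum_prod_type _).trans (Eq.trans ?_ (Fintype.sum_prod_type _).symm)
  exact Finset.sum_congr rfl fun (r : Fin n × (Fin k → Bool) × W) _ =>
    hK fun p => ψ (p.1, r.1, r.2.1, (p.2, r.2.2))

theorem Preparable.block_tableState [NeZero n] [Fintype C] [Fintype W] {i₀ b₀ : Fin n}
    {a₀ : C × W} {q : ℕ}
    {τ : (Fin n → Fin n) → W} {φ : (Fin n → Fin n) → (Fin k → Bool) → Fin n × C → ℂ}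
    (h : Preparable i₀ b₀ a₀ q fun f y => tableState (fun _ => 0) y (τ f) (φ f y))
    (K : (Fin n × C → ℂ) →ₗ[ℂ] (Fin n × C → ℂ))
    (hK : ∀ φ, ∑ p, ‖K φ p‖ ^ 2 = ∑ p, ‖φ p‖ ^ 2) :
    Preparable i₀ b₀ a₀ q fun f y => tableState (fun _ => 0) y (τ f) (K (φ f y)) := by
  convert h.block K hK using 3 with f y
  ext s
  by_cases hs : s.2.1 = 0 ∧ s.2.2.1 = y ∧ s.2.2.2.2 = τ f
  · simp only [tableState, if_pos hs]
  · simp only [tableState, if_neg hs]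
    exact (congrFun K.map_zero _).symm

/-- Diffusion on the query register. -/
noncomputable def queryDiffusion (n : ℕ) (C : Type) :
    (Fin n × C → ℂ) →ₗ[ℂ] (Fin n × C → ℂ) where
  toFun φ p := diffusion n (fun x => φ (x, p.2)) p.1
  map_add' φ ψ := by
    ext p
    exact congrFun ((diffusion n).map_add (fun x => φ (x, p.2)) fun x => ψ (x, p.2)) _
  map_smul' a φ := by
    ext p
    exact congrFun ((diffusion n).map_smul a fun x => φ (x, p.2)) _

theorem sum_norm_sq_queryDiffusion [NeZero n] {C : Type} [Fintype C] (φ : Fin n × C → ℂ) :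
    ∑ p, ‖queryDiffusion n C φ p‖ ^ 2 = ∑ p, ‖φ p‖ ^ 2 := by
  rw [Fintype.sum_prod_type_right, Fintype.sum_prod_type_right]
  exact Finset.sum_congr rfl fun c _ => sum_norm_sq_diffusion fun x => φ (x, c)

/-- A phase controlled by the value `f x` costs two queries: compute the value into the
answer register, apply the phase, and uncompute. Negation of the answer register before the second
query turns the addition of `f x` into its subtraction. -/
theorem Preparable.groverStep [NeZero n] [Fintype C] [Fintype W] {i₀ b₀ : Fin n}
    {a₀ : C × W} {q : ℕ}
    {τ : (Fin n → Fin n) → W} {φ : (Fin n → Fin n) → (Fin k → Bool) → Fin n × C → ℂ}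
    (h : Preparable i₀ b₀ a₀ q fun f y => tableState (fun _ => 0) y (τ f) (φ f y))
    (P : (Fin k → Bool) → W → Fin n → Fin n → C → Prop)
    [∀ y w x v c, Decidable (P y w x v c)] :
    Preparable i₀ b₀ a₀ (q + 2) fun f y => tableState (fun _ => 0) y (τ f)
      (queryDiffusion n C fun p =>
        if P y (τ f) p.1 (f p.1) p.2 then -φ f y p else φ f y p) := by
  have h1 := h.query.phase fun s => P s.2.2.1 s.2.2.2.2 s.1 s.2.1 s.2.2.2.1
  have h2 := h1.perm ((Equiv.refl _).prodCongr ((Equiv.neg _).prodCongr (Equiv.refl _)))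
  refine Preparable.block_tableState ?_ _ sum_norm_sq_queryDiffusion
  convert h2.query using 3 with f y
  rw [oracleApply_tableState]
  ext ⟨x, b, y', c, w⟩
  by_cases hs : b = 0 ∧ y' = y ∧ w = τ f
  · obtain ⟨rfl, rfl, rfl⟩ := hs
    simp [tableState, oracleApply]
  · have hs' : ¬ (-(b - f x) = 0 + f x ∧ y' = y ∧ w = τ f) := by
      rwa [zero_add, neg_sub, sub_eq_self]
    simp only [tableState, oracleApply, Equiv.prodCongr_apply, Prod.map, Equiv.refl_apply,
      Equiv.neg_apply, if_neg hs, if_neg hs', neg_zero, ite_self]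

theorem single_comp_perm {B : Type*} [DecidableEq B] (σ : Equiv.Perm B) (a : B) :
    (fun s => (Pi.single (σ a) 1 : B → ℂ) (σ s)) = Pi.single a 1 := by
  ext s
  simp only [Pi.single_apply, σ.injective.eq_iff]

theorem oracleApply_single [NeZero n] {A : Type} [DecidableEq A] (f : Fin n → Fin n)
    (x b : Fin n) (y : Fin k → Bool) (a : A) :
    oracleApply f (Pi.single (x, b, y, a) 1 : BasisLabel n k A → ℂ) =
      Pi.single (x, b + f x, y, a) 1 := by
  ext ⟨x', b', y', a'⟩
  simp only [oracleApply, Pi.single_apply, Prod.mk.injEq]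
  refine if_congr ?_ rfl rfl
  constructor
  · rintro ⟨rfl, h, h'⟩
    exact ⟨rfl, by rw [← h, sub_add_cancel], h'⟩
  · rintro ⟨rfl, h, h'⟩
    exact ⟨rfl, by rw [h, add_sub_cancel_right], h'⟩

set_option synthInstance.maxSize 1000 in
/-- The values of `f` at `L` positions can be stored in the workspace with `L` queries. -/
theorem preparable_load [NeZero n] [Fintype C] {L : ℕ} (ι : Fin L → Fin n) (c₀ : C) :
    Preparable (k := k) (0 : Fin n) 0 (c₀, fun _ : Fin L => (0 : Fin n)) L fun f y =>
      Pi.single (0, 0, y, (c₀, fun i => f (ι i))) 1 := by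
  suffices H : ∀ t ≤ L,
      Preparable (k := k) (0 : Fin n) 0 (c₀, fun _ : Fin L => (0 : Fin n)) t fun f y =>
        Pi.single (0, 0, y, (c₀, fun i : Fin L => if i.val < t then f (ι i) else 0)) 1 by
    simpa using H L le_rfl
  intro t
  induction t with
  | zero =>
    intro _
    simpa using Preparable.init (k := k) (0 : Fin n) 0 (c₀, fun _ : Fin L => (0 : Fin n))
  | succ t ih =>
    intro ht
    let j : Fin L := ⟨t, ht⟩
    let σ : Equiv.Perm (BasisLabel n k (C × (Fin L → Fin n))) :=
      (Equiv.subRight (ι j)).prodCongr (Equiv.refl _)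
    -- exchange the answer register with entry `j` of the table
    let ρ : Equiv.Perm (BasisLabel n k (C × (Fin L → Fin n))) :=
      Function.Involutive.toPerm
        (fun s => (s.1, s.2.2.2.2 j, s.2.2.1, (s.2.2.2.1, Function.update s.2.2.2.2 j s.2.1)))
        (fun s => by simp)
    have h := (((ih (by omega)).perm σ).query.perm ρ).perm σ.symm
    convert h using 3 with f y
    have h1 : ((0 : Fin n), (0 : Fin n), y,
          (c₀, fun i : Fin L => if i.val < t then f (ι i) else 0)) =
        σ (ι j, 0, y, (c₀, fun i : Fin L => if i.val < t then f (ι i) else 0)) := by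
      simp [σ]
    have h2 : (ι j, 0 + f (ι j), y,
          (c₀, fun i : Fin L => if i.val < t then f (ι i) else 0)) =
        ρ (ι j, 0, y, (c₀, fun i : Fin L => if i.val < t + 1 then f (ι i) else 0)) := by
      refine Prod.ext rfl (Prod.ext ?_ (Prod.ext rfl (Prod.ext rfl ?_)))
      · change 0 + f (ι j) = if j.val < t + 1 then f (ι j) else 0
        simp [j]
      change _ = Function.update _ j 0
      ext i
      by_cases hi : i = j
      · subst hi; simp [j]
      · have hi' : i.val ≠ t := fun h => hi (Fin.ext h)
        rw [Function.update_of_ne hi]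
        have : i.val < t + 1 ↔ i.val < t := by omega
        simp only [this]
    have h3 : (ι j, (0 : Fin n), y,
          (c₀, fun i : Fin L => if i.val < t + 1 then f (ι i) else 0)) =
        σ.symm (0, 0, y, (c₀, fun i : Fin L => if i.val < t + 1 then f (ι i) else 0)) := by
      rw [Equiv.eq_symm_apply]
      simp [σ]
    rw [h1, single_comp_perm, oracleApply_single, h2]
    refine Eq.trans ?_ (funext fun s => congrFun (single_comp_perm ρ _) (σ.symm s)).symm
    rw [h3, single_comp_perm]

/-- There is a unitary taking a given basis vector to the uniform unit vector; its inverse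
turns the amplitude along the uniform vector into the amplitude of that basis vector. -/
theorem exists_isometry_uniform {X : Type*} [Fintype X] [DecidableEq X] (x₀ : X) :
    ∃ K K' : (X → ℂ) →ₗ[ℂ] (X → ℂ),
      (∀ φ, ∑ p, ‖K φ p‖ ^ 2 = ∑ p, ‖φ p‖ ^ 2) ∧
      (∀ φ, ∑ p, ‖K' φ p‖ ^ 2 = ∑ p, ‖φ p‖ ^ 2) ∧
      K (Pi.single x₀ 1) = (fun _ => ((√(Fintype.card X) : ℝ) : ℂ)⁻¹) ∧
      ∀ φ, K' φ x₀ = ((√(Fintype.card X) : ℝ) : ℂ)⁻¹ * ∑ x, φ x := by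
  have hX : (0 : ℝ) < Fintype.card X := Nat.cast_pos.2 (Fintype.card_pos_iff.2 ⟨x₀⟩)
  let u : EuclideanSpace ℂ X := WithLp.toLp 2 fun _ => ((√(Fintype.card X) : ℝ) : ℂ)⁻¹
  have hu : ‖u‖ = 1 := by
    rw [EuclideanSpace.norm_eq, Real.sqrt_eq_one]
    simp [u, hX.ne']
  have hb : ∃ b : OrthonormalBasis X ℂ (EuclideanSpace ℂ X), b x₀ = u := by
    obtain ⟨b, hb⟩ := Orthonormal.exists_orthonormalBasis_extension_of_card_eq
      (𝕜 := ℂ) (E := EuclideanSpace ℂ X) (ι := X) (by simp) (v := fun _ => u) (s := {x₀})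
      ⟨fun _ => hu, fun i j hij => (hij (Subsingleton.elim i j)).elim⟩
    exact ⟨b, hb x₀ rfl⟩
  have h7 : ∀ x, u x = ((√(Fintype.card X) : ℝ) : ℂ)⁻¹ := fun _ => rfl
  clear_value u
  obtain ⟨b, hb⟩ := hb
  have hiso : ∀ e : EuclideanSpace ℂ X ≃ₗᵢ[ℂ] EuclideanSpace ℂ X, ∀ φ : X → ℂ,
      ∑ p, ‖e (WithLp.toLp 2 φ) p‖ ^ 2 = ∑ p, ‖φ p‖ ^ 2 := fun e φ => by
    rw [← EuclideanSpace.norm_sq_eq, e.norm_map, EuclideanSpace.norm_sq_eq]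
  refine ⟨(WithLp.linearEquiv 2 ℂ (X → ℂ)).toLinearMap ∘ₗ
      b.repr.symm.toLinearEquiv.toLinearMap ∘ₗ (WithLp.linearEquiv 2 ℂ (X → ℂ)).symm.toLinearMap,
    (WithLp.linearEquiv 2 ℂ (X → ℂ)).toLinearMap ∘ₗ
      b.repr.toLinearEquiv.toLinearMap ∘ₗ (WithLp.linearEquiv 2 ℂ (X → ℂ)).symm.toLinearMap,
    fun φ => hiso b.repr.symm φ, fun φ => hiso b.repr φ, ?_, fun φ => ?_⟩
  · ext x
    have := b.repr_symm_single x₀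
    rw [hb] at this
    rw [← h7 x, ← this]
    rfl
  · have := b.repr_apply_apply (WithLp.toLp 2 φ) x₀
    rw [hb, PiLp.inner_apply] at this
    rw [Finset.mul_sum]
    refine this.trans (Finset.sum_congr rfl fun x _ => ?_)
    simp [h7, mul_comm]

set_option synthInstance.maxSize 1000 in
open Classical in
/-- After `L` queries that load the values at the positions `ι`, and `2 * T` queries for `T` Grover
steps of which block `c` of a clock register performs the last `T - c`, the clock and the query
register are projected onto the uniform superposition. The acceptance amplitude is the overlap of
the average of `T` Grover iterates with the uniform vector: it is `1` if no input is marked, and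
small if many are. -/
theorem exists_search_verifier [NeZero n] {L T : ℕ} [NeZero T] (ι : Fin L → Fin n)
    (M : (Fin k → Bool) → (Fin L → Fin n) → Fin n → Fin n → Prop) :
    ∃ V : QuantumVerifier n k, V.queries = L + 2 * T ∧
      ∀ (f : Fin n → Fin n) (y : Fin k → Bool) (m : Finset (Fin n)),
        m = (Finset.univ.filter fun x => M y (fun i => f (ι i)) x (f x)) →
        (m = ∅ → V.acceptProb f y = 1) ∧ V.acceptProb f y * (m.card * T ^ 2) ≤ n := by
  obtain ⟨K, K', hK, hK', hK0, hK0'⟩ := exists_isometry_uniform ((0 : Fin n), (0 : Fin T))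
  rw [Fintype.card_prod, Fintype.card_fin, Fintype.card_fin] at hK0 hK0'
  set a : ℂ := ((√((n * T : ℕ) : ℝ) : ℝ) : ℂ)⁻¹ with ha
  let marked : (Fin n → Fin n) → (Fin k → Bool) → Finset (Fin n) := fun f y =>
    Finset.univ.filter fun x => M y (fun i => f (ι i)) x (f x)
  have hsteps : ∀ j : ℕ, Preparable (k := k) (0 : Fin n) 0
      ((0 : Fin T), fun _ : Fin L => (0 : Fin n)) (L + 2 * j) fun f y =>
        tableState (fun _ => 0) y (fun i => f (ι i)) fun p =>
          a * (groverStep (marked f y) ^ (j - p.2.val)) 1 p.1 := by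
    intro j
    induction j with
    | zero =>
      have h : Preparable (k := k) (0 : Fin n) 0 ((0 : Fin T), fun _ : Fin L => (0 : Fin n)) L
          fun f y => tableState (fun _ => 0) y (fun i => f (ι i)) (Pi.single (0, 0) 1) := by
        convert preparable_load (k := k) ι (0 : Fin T) using 3 with f y
        rw [← single_eq_tableState]
      have h' := h.block_tableState K hK
      rw [hK0] at h'
      simpa using h'
    | succ j ih =>
      have h := ih.groverStep fun y w x v c => M y w x v ∧ c.val ≤ j
      rw [show L + 2 * (j + 1) = L + 2 * j + 2 by ring]
      convert h using 4 with f y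
      ext ⟨x, c⟩
      change _ = diffusion n (fun x => if M y (fun i => f (ι i)) x (f x) ∧ c.val ≤ j then
        -(a * (groverStep (marked f y) ^ (j - c.val)) 1 x) else
        a * (groverStep (marked f y) ^ (j - c.val)) 1 x) x
      by_cases hc : c.val ≤ j
      · rw [show j + 1 - c.val = (j - c.val) + 1 by omega, pow_succ', Module.End.mul_apply,
          groverStep_apply, ← smul_eq_mul, ← Pi.smul_apply, ← map_smul]
        refine congrFun (congrArg _ (funext fun x' => ?_)) x
        simp [marked, hc]
      · -- before its first step, a block is in the uniform state, which the diffusion fixes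
        rw [show j + 1 - c.val = 0 by omega, show j - c.val = 0 by omega]
        simp only [hc, and_false, if_false, pow_zero, Module.End.one_apply]
        have := congrFun (map_smul (diffusion n) a 1) x
        rw [diffusion_one] at this
        exact this.symm
  obtain ⟨U, hU⟩ := (hsteps T).block_tableState K' hK'
  let acc : Finset (BasisLabel n k (Fin T × (Fin L → Fin n))) :=
    Finset.univ.filter fun s => s.1 = 0 ∧ s.2.2.2.1 = 0
  refine ⟨⟨_, L + 2 * T, 0, 0, (0, fun _ => 0), U, acc⟩, rfl, fun f y m hm => ?_⟩
  have hnT : (0 : ℝ) < (n * T : ℕ) := Nat.cast_pos.2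
    (Nat.mul_pos (NeZero.pos n) (NeZero.pos T))
  have hn : (0 : ℝ) < n := Nat.cast_pos.2 (NeZero.pos n)
  have hT : (0 : ℝ) < T := Nat.cast_pos.2 (NeZero.pos T)
  have hprob : (QuantumVerifier.mk _ (L + 2 * T) 0 0 (0, fun _ => 0) U acc).acceptProb f y =
      ((n * T : ℕ) ^ 2 : ℝ)⁻¹ *
        ‖∑ x, ∑ i ∈ Finset.range T, (groverStep m ^ (i + 1)) 1 x‖ ^ 2 := by
    rw [QuantumVerifier.acceptProb]
    simp only [hU]
    rw [Finset.sum_eq_single (0, 0, y, (0, fun i => f (ι i)))]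
    · rw [tableState, if_pos ⟨rfl, rfl, rfl⟩, hK0', ← Finset.mul_sum, ← mul_assoc, norm_mul,
        mul_pow, Fintype.sum_prod_type, hm]
      congr 1
      · rw [norm_mul, ha, norm_inv, Complex.norm_real, Real.norm_eq_abs,
          abs_of_nonneg (Real.sqrt_nonneg _), ← mul_inv, Real.mul_self_sqrt hnT.le, inv_pow]
      · congr 2
        refine Finset.sum_congr rfl fun x _ => ?_
        rw [Fin.sum_univ_eq_sum_range
          (fun c => (groverStep (marked f y) ^ (T - c)) 1 x) T, ← Finset.sum_range_reflect]
        refine Finset.sum_congr rfl fun i hi => ?_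
        have := Finset.mem_range.1 hi
        rw [show T - (T - 1 - i) = i + 1 by omega]
    · rintro ⟨x, b, y', c, w⟩ hs hne
      simp only [acc, Finset.mem_filter, Finset.mem_univ, true_and] at hs
      obtain ⟨rfl, rfl⟩ := hs
      rw [tableState, if_neg, norm_zero, zero_pow two_ne_zero]
      rintro ⟨hb, hy, hw⟩
      exact hne (by simp_all)
    · intro h
      exact (h (by simp [acc])).elim
  rw [hprob]
  refine ⟨fun h0 => ?_, ?_⟩
  · rw [h0]
    simp only [groverStep_pow_one_of_empty]
    simp
    field_simp
  · have := card_mul_norm_sum_groverStep_sq_le m T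
    push_cast
    rw [inv_mul_eq_div, div_mul_eq_mul_div, div_le_iff₀ (by positivity)]
    nlinarith [mul_le_mul_of_nonneg_left this (sq_nonneg (T : ℝ))]

end Verifier

/-! ### The collision protocol -/

/-- If an honest table of the values at `r` positions can be obtained from the witness and `L`
queried values, then a search for marked inputs with `T ≥ √(6 n / r)` Grover steps is a collision
protocol. -/
theorem exists_isCollisionProtocol {n k L r T : ℕ} [NeZero n] [NeZero T]
    {ι : Fin r → Fin n} (hι : Function.Injective ι) (κ : Fin L → Fin n)
    (tab : (Fin k → Bool) → (Fin L → Fin n) → Fin r → Fin n)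
    (htab : ∀ f : Fin n → Fin n, ∃ y, tab y (fun i => f (κ i)) = fun i => f (ι i))
    (hT : 6 * n ≤ r * T ^ 2) :
    ∃ V : QuantumVerifier n k, V.queries = L + 2 * T ∧ V.IsCollisionProtocol := by
  classical
  obtain ⟨V, hq, hV⟩ := exists_search_verifier (T := T) κ fun y w => Marked ι (tab y w)
  refine ⟨V, hq, fun f hf => ?_, fun f hf y => ?_⟩
  · obtain ⟨y, hy⟩ := htab f
    refine ⟨y, ?_⟩
    rw [(hV f y _ rfl).1 (Finset.filter_false_of_mem fun x _ => ?_)]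
    · norm_num
    · rw [hy]
      exact not_marked_of_injective hι hf x
  · have h1 := (hV f y _ rfl).2
    have h2 := hf.le_two_mul_card_marked hι (tab y fun i => f (κ i))
    set m := (Finset.univ.filter fun x => Marked ι (tab y fun i => f (κ i)) x (f x)).card
    have hn : (0 : ℝ) < n := Nat.cast_pos.2 (NeZero.pos n)
    have h3 : 3 * n ≤ m * T ^ 2 := by nlinarith [Nat.mul_le_mul_right (T ^ 2) h2]
    have h4 : (3 * n : ℝ) ≤ m * T ^ 2 := by exact_mod_cast h3
    have hp : 0 ≤ V.acceptProb f y := Finset.sum_nonneg fun s _ => sq_nonneg _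
    have h5 : V.acceptProb f y * (3 * n) ≤ n := (mul_le_mul_of_nonneg_left h4 hp).trans h1
    by_contra! h6
    nlinarith

/-- The Brassard-Høyer-Tapp regime: the table is loaded by `⌈n^{1/3}⌉` queries. -/
theorem exists_isCollisionProtocol_of_queries (n : ℕ) [NeZero n] :
    ∃ V : QuantumVerifier n 0, (V.queries : ℝ) ≤ 14 * (n : ℝ) ^ (1 / 3 : ℝ) ∧
      V.IsCollisionProtocol := by
  have hn : (1 : ℝ) ≤ n := by exact_mod_cast NeZero.one_le
  set c : ℝ := (n : ℝ) ^ (1 / 3 : ℝ) with hc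
  have hc1 : 1 ≤ c := Real.one_le_rpow hn (by norm_num)
  have hc3 : c ^ 3 = n := by
    rw [hc, ← Real.rpow_natCast, ← Real.rpow_mul (by linarith)]
    norm_num
  have hcn : c ≤ n := by nlinarith [sq_nonneg (c - 1), sq_nonneg c]
  set r := ⌈c⌉₊ with hr
  have hcr : c ≤ r := Nat.le_ceil c
  have hr2 : (r : ℝ) < c + 1 := Nat.ceil_lt_add_one (by linarith)
  have hrn : r ≤ n := Nat.ceil_le.2 hcn
  have hr0 : 0 < r := Nat.ceil_pos.2 (by linarith)
  have : NeZero (3 * r) := ⟨by omega⟩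
  have hr3 : n ≤ r ^ 3 := by
    have : (n : ℝ) ≤ (r : ℝ) ^ 3 := by rw [← hc3]; gcongr
    exact_mod_cast this
  obtain ⟨V, hq, hV⟩ := exists_isCollisionProtocol (k := 0) (T := 3 * r)
    (Fin.castLE_injective hrn) (Fin.castLE hrn) (fun _ w => w) (fun f => ⟨default, rfl⟩)
    (by nlinarith)
  refine ⟨V, ?_, hV⟩
  rw [hq]
  push_cast
  linarith

/-- The witness regime: the witness encodes the table of the first `r` values. -/
theorem exists_isCollisionProtocol_of_witness (n : ℕ) [NeZero n] {r : ℕ} (hr : 1 ≤ r)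
    (hrn : r ≤ n) :
    ∃ V : QuantumVerifier n (Nat.clog 2 (n ^ r)),
      (V.queries : ℝ) ≤ 2 * (√(6 * n / r) + 1) ∧ V.IsCollisionProtocol := by
  have hn : (0 : ℝ) < n := Nat.cast_pos.2 (NeZero.pos n)
  have hr' : (0 : ℝ) < r := Nat.cast_pos.2 hr
  have hpos : 0 < √(6 * n / r : ℝ) := Real.sqrt_pos.2 (by positivity)
  set T := ⌈√(6 * n / r : ℝ)⌉₊ with hTdef
  have : NeZero T := ⟨(Nat.ceil_pos.2 hpos).ne'⟩
  have hT : 6 * n ≤ r * T ^ 2 := by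
    have h1 : (6 * n / r : ℝ) ≤ (T : ℝ) ^ 2 := by
      rw [← Real.sq_sqrt (by positivity : (0 : ℝ) ≤ 6 * n / r)]
      exact pow_le_pow_left₀ hpos.le (Nat.le_ceil _) 2
    rw [div_le_iff₀ hr'] at h1
    have h2 : (6 * n : ℝ) ≤ r * T ^ 2 := by linarith
    exact_mod_cast h2
  have hcard : Fintype.card (Fin r → Fin n) ≤
      Fintype.card (Fin (Nat.clog 2 (n ^ r)) → Bool) := by
    simpa using Nat.le_pow_clog one_lt_two (n ^ r)
  obtain ⟨e⟩ := Function.Embedding.nonempty_of_card_le hcard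
  obtain ⟨V, hq, hV⟩ := exists_isCollisionProtocol (L := 0) (T := T)
    (Fin.castLE_injective hrn) (fun i => i.elim0) (fun y _ => Function.invFun e y)
    (fun f => ⟨e fun i => f (Fin.castLE hrn i), Function.leftInverse_invFun e.injective _⟩) hT
  refine ⟨V, ?_, hV⟩
  rw [hq]
  have := Nat.ceil_lt_add_one hpos.le
  push_cast
  linarith

theorem clog_pow_le_mul_logb {n r : ℕ} (hn : 2 ≤ n) (hr : 1 ≤ r) :
    (Nat.clog 2 (n ^ r) : ℝ) ≤ 2 * r * Real.logb 2 n := by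
  have h1 : 1 ≤ Real.logb 2 n := by
    rw [Real.le_logb_iff_rpow_le one_lt_two (by positivity), Real.rpow_one]
    exact_mod_cast hn
  have h2 : (1 : ℝ) ≤ r := by exact_mod_cast hr
  have h3 : (1 : ℝ) ≤ r * Real.logb 2 n := by nlinarith
  have h4 : Nat.clog 2 (n ^ r) = ⌈Real.logb 2 ((n ^ r : ℕ) : ℝ)⌉₊ := by
    simpa using (Real.natCeil_logb_natCast 2 (n ^ r)).symm
  have h5 : Real.logb 2 ((n ^ r : ℕ) : ℝ) = r * Real.logb 2 n := by
    rw [Nat.cast_pow, Real.logb_pow]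
  rw [h4, h5]
  linarith [Nat.ceil_lt_add_one (by linarith : 0 ≤ (r : ℝ) * Real.logb 2 n)]

theorem theorem2p3 :
    ∃ C : ℝ, ∀ n : ℕ, 1 ≤ n → ∀ w : ℝ, 0 ≤ w → w ≤ (n : ℝ) →
      ∃ (k : ℕ) (V : QuantumVerifier n k),
        (k : ℝ) ≤ w * Real.logb 2 (n : ℝ) ∧
        (V.queries : ℝ) ≤ C * collisionQueryBound n w ∧
        V.IsCollisionProtocol := by
  -- `28 = 2 * 14`: loading is used unless `n^{1/3}` exceeds twice the bound
  refine ⟨28, fun n hn w hw hwn => ?_⟩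
  have : NeZero n := ⟨by omega⟩
  have hn' : (1 : ℝ) ≤ n := by exact_mod_cast hn
  have hc0 : 0 < (n : ℝ) ^ (1 / 3 : ℝ) := Real.rpow_pos_of_pos (by linarith) _
  by_cases hcase : (n : ℝ) ^ (1 / 3 : ℝ) ≤ 2 * collisionQueryBound n w
  · obtain ⟨V, hq, hV⟩ := exists_isCollisionProtocol_of_queries n
    refine ⟨0, V, ?_, by linarith, hV⟩
    rw [Nat.cast_zero]
    exact mul_nonneg hw (Real.logb_nonneg one_lt_two hn')
  · rw [not_le] at hcase
    have hw0 : w ≠ 0 := by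
      rintro rfl
      rw [collisionQueryBound, if_pos rfl] at hcase
      linarith
    have hwpos : 0 < w := lt_of_le_of_ne hw hw0.symm
    have hbound : collisionQueryBound n w = √(n / w) := by
      rw [collisionQueryBound, if_neg hw0] at hcase ⊢
      refine min_eq_left (le_of_not_gt fun h => ?_)
      rw [min_eq_right h.le] at hcase
      linarith
    rw [hbound] at hcase ⊢
    -- a witness of fewer than two values would not beat the bound `n^{1/3}`
    have hw2 : 2 ≤ w := by
      by_contra! h
      have h1 : (n : ℝ) ^ (1 / 3 : ℝ) ≤ √n := by
        rw [Real.sqrt_eq_rpow]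
        exact Real.rpow_le_rpow_of_exponent_le hn' (by norm_num)
      have h2 : √(n : ℝ) ≤ 2 * √(n / w) := by
        rw [Real.sqrt_le_left (by positivity), mul_pow, Real.sq_sqrt (by positivity),
          mul_div_assoc', le_div_iff₀ hwpos]
        nlinarith
      linarith
    set r := ⌊w / 2⌋₊ with hr
    have hr1 : 1 ≤ r := Nat.le_floor (by push_cast; linarith)
    have hr1' : (1 : ℝ) ≤ r := by exact_mod_cast hr1
    have hrw : (r : ℝ) ≤ w / 2 := Nat.floor_le (by linarith)
    have hwr : w / 2 < r + 1 := Nat.lt_floor_add_one _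
    have hrn : r ≤ n := by
      have : (r : ℝ) ≤ n := by linarith
      exact_mod_cast this
    have hn2 : 2 ≤ n := by
      have : (2 : ℝ) ≤ n := by linarith
      exact_mod_cast this
    obtain ⟨V, hq, hV⟩ := exists_isCollisionProtocol_of_witness n hr1 hrn
    refine ⟨_, V, (clog_pow_le_mul_logb hn2 hr1).trans ?_, hq.trans ?_, hV⟩
    · exact mul_le_mul_of_nonneg_right (by linarith) (Real.logb_nonneg one_lt_two hn')
    · have h1 : 1 ≤ √(n / w) := Real.one_le_sqrt.2 ((one_le_div hwpos).2 hwn)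
      have h2 : √(6 * n / r : ℝ) ≤ 5 * √(n / w) := by
        rw [Real.sqrt_le_left (by positivity), mul_pow, Real.sq_sqrt (by positivity),
          mul_div_assoc', div_le_div_iff₀ (by linarith) hwpos]
        nlinarith
      linarith
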